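/- Conventions. Algebraic languages have operation symbols of finite arity; $Tm(\mathscr L,V)$ is the set of $\mathscr L$-terms in variables $V$, and $Eq(\mathscr L,V)=Tm(\mathscr L,V)^2$ the set of equations. A generalized quasi-equation is an implication $\bigwedge_{i\in I}\alpha_i\approx\beta_i\to\varphi\approx\psi$ with $I$ an arbitrary set (a quasi-equation if $I$ is finite). A generalized quasi-variety is a class of algebras axiomatized by generalized quasi-equations whose number of variables is bounded by some infinite cardinal, and a quasi-variety is one axiomatized by quasi-equations; if the language has no constant symbol, the empty algebra is included. Such classes are regarded as categories with homomorphisms as arrows. For a class $\mathsf C$ of similar algebras, $\Phi\vDash_{\mathsf C}\epsilon\approx\delta$ means that every assignment in a member of $\mathsf C$ satisfying $\Phi$ satisfies $\epsilon\approx\delta$ (and $\Phi\vDash_{\mathsf C}\Psi$ that this holds for every equation in $\Psi$); $\mathbb Q(\mathsf C)$ is the class of models of all quasi-equations valid in $\mathsf C$; $\mathbb{GQ}_\lambda(\mathsf C)$ is the class of models of all generalized quasi-equations in at most $\lambda$ variables valid in $\mathsf C$; $\mathbb U_\lambda(\mathsf C)$ is the class of algebras all of whose $\lambda$-generated subalgebras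 are in $\mathsf C$. Matrix powers. Let $\kappa>0$ be a cardinal. For a language $\mathscr L$, the $n$-ary symbols of $\mathscr L^\kappa$ are the $\kappa$-sequences $\langle t_i:i<\kappa\rangle$ of $\mathscr L$-terms in the variables $x^j_m$ ($j<\kappa$, $1\le m\le n$). For an $\mathscr L$-algebra $A$, $A^{[\kappa]}$ is the $\mathscr L^\kappa$-algebra with universe $A^\kappa$ in which $\langle t_i\rangle(a_1,\dots,a_n)=\langle t_i^A(a_1/\vec x_1,\dots,a_n/\vec x_n):i<\kappa\rangle$, where $\vec x_m=\langle x^j_m:j<\kappa\rangle$; for a homomorphism $f$, $f^{[\kappa]}$ applies $f$ componentwise; $\mathsf Y^{[\kappa]}$ is the class of isomorphic copies of the algebras $A^{[\kappa]}$, $A\in\mathsf Y$. Translations. Let $\mathsf X,\mathsf Y$ be generalized quasi-varieties in languages $\mathscr L_{\mathsf X},\mathscr L_{\mathsf Y}$. A $\kappa$-translation is an arity-preserving map $\tau:\mathscr L_{\mathsf X}\to\mathscr L_{\mathsf Y}^\kappa$. It extends to maps $\tau_*:Tm(\mathscr L_{\mathsf X},\mu)\to Tm(\mathscr L_{\mathsf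 Y},\kappa\times\mu)^\kappa$ by $\tau_*(x_j)=\vec x_j=\langle x^i_j:i<\kappa\rangle$ and $\tau_*(\psi(\varphi_1,\dots,\varphi_n))(i)=\tau(\psi)_i(\tau_*(\varphi_1)/\vec x_1,\dots,\tau_*(\varphi_n)/\vec x_n)$; put $\tau^*(\Phi)=\{\tau_*(\epsilon)(i)\approx\tau_*(\delta)(i):i<\kappa,\ \epsilon\approx\delta\in\Phi\}$. A pair $\langle\tau,\Theta\rangle$ with $\Theta=\Theta(\vec x)\subseteq Eq(\mathscr L_{\mathsf Y},\kappa)$ is a contextual $\kappa$-translation of $\vDash_{\mathsf X}$ into $\vDash_{\mathsf Y}$ if (1) for every cardinal $\mu$ and $\Phi\cup\{\epsilon\approx\delta\}\subseteq Eq(\mathscr L_{\mathsf X},\mu)$, $\Phi\vDash_{\mathsf X}\epsilon\approx\delta$ implies $\tau^*(\Phi)\cup\bigcup_{j<\mu}\Theta(\vec x_j)\vDash_{\mathsf Y}\tau^*(\{\epsilon\approx\delta\})$; and (2) $\Theta(\vec x_1)\cup\dots\cup\Theta(\vec x_n)\vDash_{\mathsf Y}\Theta(\tau_*(\psi(x_1,\dots,x_n)))$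 for every $n$-ary $\psi\in\mathscr L_{\mathsf X}$. It is non-trivial if, whenever some $\kappa$-sequence $\vec\varphi$ of closed $\mathscr L_{\mathsf Y}$-terms satisfies $\mathsf Y\vDash\Theta(\vec\varphi)$, there is $i_0<\kappa$ with $\Theta(\vec x)\cup\Theta(\vec y)\nvDash_{\mathsf Y}x^{i_0}\approx y^{i_0}$, where $\vec x,\vec y$ are disjoint sequences of distinct variables. The construction. Given a non-trivial contextual $\kappa$-translation $\langle\tau,\Theta\rangle$, let $\mathscr L=\{\tau(\psi):\psi\in\mathscr L_{\mathsf X}\}\subseteq\mathscr L_{\mathsf Y}^\kappa$ and $\theta=\{\vec\epsilon\approx\vec\delta:\epsilon\approx\delta\in\Theta\}$, where $\vec\epsilon$ is the $\kappa$-sequence constantly equal to $\epsilon$, viewed as a unary term of $\mathscr L_{\mathsf Y}^\kappa$. Let $\mathsf K=\mathbb Q(\mathsf Y^{[\kappa]})$ if $\mathsf X$ and $\mathsf Y$ are quasi-varieties and the least congruence of the free algebra $Tm_{\mathsf Y}(\kappa)$ that contains $\Theta$ and has quotient in $\mathsf Y$ is finitely generated as a congruence with quotient in $\mathsf Y$;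 otherwise let $\mathsf K=\mathbb{GQ}_\lambda(\mathsf Y^{[\kappa]})$, where $\lambda$ is any infinite cardinal such that $\mathbb U_\lambda(\mathsf X)=\mathsf X$ (such a $\lambda$ exists). For $B\in\mathsf K$ let $\theta_{\mathscr L}(B)$ be the set of solutions of $\theta$ in $B$ equipped with the restrictions of the operations in $\mathscr L$, regarded as an $\mathscr L_{\mathsf X}$-algebra by interpreting $\psi$ as $\tau(\psi)$; for a homomorphism $f$, $\theta_{\mathscr L}(f)$ is its restriction. Theorem. Let $\mathsf X$ and $\mathsf Y$ be generalized quasi-varieties, $\kappa>0$ a cardinal, $\langle\tau,\Theta\rangle$ a non-trivial contextual $\kappa$-translation of $\vDash_{\mathsf X}$ into $\vDash_{\mathsf Y}$, and let $\mathsf K,\mathscr L,\theta$ be as above. Then $A\mapsto A^{[\kappa]}$ and $B\mapsto\theta_{\mathscr L}(B)$ are well-defined functors $[\kappa]:\mathsf Y\to\mathsf K$ and $\theta_{\mathscr L}:\mathsf K\to\mathsf X$ (in particular, for $B\in\mathsf K$ the solution set of $\theta$ in $B$ is closed under the operations in $\mathscr L$, and $\theta_{\mathscr L}(B)\in\mathsf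 X$), and both are right adjoints. In particular, $\theta_{\mathscr L}\circ[\kappa]:\mathsf Y\to\mathsf X$ is a right adjoint, and it is non-trivial: it does not send every object to a terminal object. -/

import Mathlib

open CategoryTheory Cardinal FirstOrder FirstOrder.Language

universe u v

namespace CtxTrans

/-! ### Algebras

An algebraic language is a `FirstOrder.Language` without relation symbols.  Algebras live in
`Type u`, the languages are in the same universe, and an algebra may have an empty universe
(which is possible only when the language has no constant symbol). -/

/-- An algebra of type `L`. -/
structure Alg (L : FirstOrder.Language.{u, 0}) where
  carrier : Type u
  [str : L.Structure carrier]

attribute [instance] Alg.str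

instance (L : FirstOrder.Language.{u, 0}) : CoeSort (Alg L) (Type u) := ⟨Alg.carrier⟩

/-- Algebras of type `L` with homomorphisms. -/
instance (L : FirstOrder.Language.{u, 0}) : Category.{u} (Alg L) where
  Hom A B := A →[L] B
  id A := Hom.id L A
  comp f g := g.comp f

/-- A class of similar algebras of type `L`; as a category it is the full subcategory
`C.FullSubcategory`. -/
abbrev AlgClass (L : FirstOrder.Language.{u, 0}) := ObjectProperty (Alg L)

/-! ### Equations, consequence, generalized quasi-equations -/

/-- `Eq(L, V)`: equations in variables `V`, i.e. pairs of terms. -/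
abbrev Equation (L : FirstOrder.Language.{u, 0}) (V : Type v) := L.Term V × L.Term V

section Equations

variable {L : FirstOrder.Language.{u, 0}}

/-- The assignment `h` satisfies the equation `e` in `A`. -/
def Sat {V : Type v} (A : Alg L) (h : V → A) (e : Equation L V) : Prop :=
  e.1.realize h = e.2.realize h

/-- Substitution of terms for the variables of an equation. -/
def substEq {V W : Type*} (σ : V → L.Term W) (e : Equation L V) : Equation L W :=
  (e.1.subst σ, e.2.subst σ)

/-- For a set `Θ` of equations in variables `V` and a `V`-sequence `σ` of terms, `Θ(σ)`. -/
def substEqs {V W : Type*} (Θ : Set (Equation L V)) (σ : V → L.Term W) : Set (Equation L W) :=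
  substEq σ '' Θ

/-- The equational consequence `Φ ⊨_C e` relative to `C`.  Homomorphisms from the term algebra
are given by assignments of the variables. -/
def Conseq (C : AlgClass L) {V : Type v} (Φ : Set (Equation L V)) (e : Equation L V) : Prop :=
  ∀ A : Alg L, C A → ∀ h : V → A, (∀ p ∈ Φ, Sat A h p) → Sat A h e

/-- A generalized quasi-equation `⋀ premises → conclusion` in variables `V`. -/
structure GenQuasiEq (L : FirstOrder.Language.{u, 0}) (V : Type v) where
  premises : Set (Equation L V)
  conclusion : Equation L V

/-- Validity of a generalized quasi-equation in an algebra. -/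
def GenQuasiEq.Holds {V : Type v} (Φ : GenQuasiEq L V) (A : Alg L) : Prop :=
  ∀ h : V → A, (∀ p ∈ Φ.premises, Sat A h p) → Sat A h Φ.conclusion

/-- `C` is a generalized quasi-variety: it is axiomatized by generalized quasi-equations whose
number of variables is bounded by an infinite cardinal (the cardinality of `V`). -/
def IsGenQuasiVariety (C : AlgClass L) : Prop :=
  ∃ (V : Type u) (_ : Infinite V) (Ax : Set (GenQuasiEq L V)), ∀ A, C A ↔ ∀ Φ ∈ Ax, Φ.Holds A

/-- `C` is a quasi-variety: it is axiomatized by quasi-equations, i.e. generalized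
quasi-equations with finitely many premises (countably many variables suffice to write them). -/
def IsQuasiVariety (C : AlgClass L) : Prop :=
  ∃ Ax : Set (GenQuasiEq L ℕ), (∀ Φ ∈ Ax, Φ.premises.Finite) ∧ ∀ A, C A ↔ ∀ Φ ∈ Ax, Φ.Holds A

/-- `GQ_lam(C)`: the models of the generalized quasi-equations in (at most) `lam` variables that
hold in `C`. -/
def GQ (lam : Cardinal.{u}) (C : AlgClass L) : AlgClass L := fun A =>
  ∀ (V : Type u), #V ≤ lam → ∀ Φ : GenQuasiEq L V, (∀ B, C B → Φ.Holds B) → Φ.Holds A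

/-- `Q(C)`: the quasi-variety generated by `C`, i.e. the models of the quasi-equations that hold
in `C`. -/
def Q (C : AlgClass L) : AlgClass L := fun A =>
  ∀ Φ : GenQuasiEq L ℕ, Φ.premises.Finite → (∀ B, C B → Φ.Holds B) → Φ.Holds A

/-- `U_lam(C)`: the algebras all of whose `lam`-generated subalgebras belong to `C`. -/
def U (lam : Cardinal.{u}) (C : AlgClass L) : AlgClass L := fun A =>
  ∀ s : Set A, #s ≤ lam → C ⟨Substructure.closure L s⟩

/-! ### Congruences and free algebras -/

/-- `r` is a congruence of `A`. -/
def IsCongruence (A : Alg L) (r : Setoid A) : Prop :=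
  ∀ (n : ℕ) (f : L.Functions n) (x y : Fin n → A),
    (∀ i, r (x i) (y i)) → r (Structure.funMap f x) (Structure.funMap f y)

/-- The quotient algebra `A / r`.  Operations are computed on representatives, which does not
depend on their choice when `r` is a congruence. -/
noncomputable def quotAlg (A : Alg L) (r : Setoid A) : Alg L where
  carrier := Quotient r
  str :=
    { funMap := fun f x => Quotient.mk r (Structure.funMap f fun i => (x i).out)
      RelMap := fun _ _ => False }

/-- `r` is a `C`-congruence of `A`. -/
def IsRelCongruence (C : AlgClass L) (A : Alg L) (r : Setoid A) : Prop :=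
  IsCongruence A r ∧ C (quotAlg A r)

/-- `Cg_C^A(S)`: the least `C`-congruence of `A` containing `S`. -/
def Cg (C : AlgClass L) (A : Alg L) (S : Set (A × A)) : Setoid A :=
  sInf {r | IsRelCongruence C A r ∧ ∀ p ∈ S, r p.1 p.2}

/-- The term algebra over the variables `V`. -/
def termAlg (L : FirstOrder.Language.{u, 0}) (V : Type u) : Alg L where
  carrier := L.Term V
  str :=
    { funMap := fun f ts => Term.func f ts
      RelMap := fun _ _ => False }

/-- Two terms are identified when `C ⊨ s ≈ t`. -/
def freeSetoid (C : AlgClass L) (V : Type u) : Setoid (termAlg L V) where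
  r s t := Conseq C ∅ ((s, t) : Equation L V)
  iseqv :=
    { refl := fun _ _ _ _ _ => rfl
      symm := fun h A hA a ha => (h A hA a ha).symm
      trans := fun h k A hA a ha => (h A hA a ha).trans (k A hA a ha) }

/-- `Tm_C(V)`: the free algebra of `C` with free generators `V`, as a quotient of the term
algebra. -/
noncomputable def freeAlg (C : AlgClass L) (V : Type u) : Alg L :=
  quotAlg (termAlg L V) (freeSetoid C V)

/-- A set of equations in variables `V`, viewed as a set of pairs of elements of `Tm_C(V)`. -/
def eqsInFree (C : AlgClass L) {V : Type u} (Θ : Set (Equation L V)) :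
    Set (freeAlg C V × freeAlg C V) :=
  (fun e => (Quotient.mk (freeSetoid C V) e.1, Quotient.mk (freeSetoid C V) e.2)) '' Θ

/-- The `C`-congruence of `Tm_C(V)` generated by `Θ` is finitely generated. -/
def CgFinitelyGenerated (C : AlgClass L) {V : Type u} (Θ : Set (Equation L V)) : Prop :=
  ∃ F : Set (freeAlg C V × freeAlg C V), F.Finite ∧
    Cg C (freeAlg C V) F = Cg C (freeAlg C V) (eqsInFree C Θ)

end Equations

/-! ### Matrix powers

A cardinal `κ > 0` is represented by a nonempty index type `κ`. -/

/-- The language `L^κ`: the `n`-ary operations are the `κ`-sequences of terms of `L` in the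
variables `x^j_m`, written `(j, m)`, with `j : κ` and `m : Fin n`. -/
def matrixLang (L : FirstOrder.Language.{u, 0}) (κ : Type u) : FirstOrder.Language.{u, 0} :=
  ⟨fun n => κ → L.Term (κ × Fin n), fun _ => Empty⟩

/-- The matrix power `A^[κ]`. -/
def matrixAlg {L : FirstOrder.Language.{u, 0}} (κ : Type u) (A : Alg L) : Alg (matrixLang L κ) where
  carrier := κ → A
  str :=
    { funMap := fun t a i => Term.realize (fun p => a p.2 p.1) (t i)
      RelMap := fun r _ => Empty.elim r }

/-- The functor `[κ]`, `A ↦ A^[κ]`, which maps `f` to its componentwise application. -/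
def matrixPower (L : FirstOrder.Language.{u, 0}) (κ : Type u) : Alg L ⥤ Alg (matrixLang L κ) where
  obj A := matrixAlg κ A
  map {A B} f :=
    { toFun := fun a i => (show A →[L] B from f) (a i)
      map_fun' := fun t a => funext fun i =>
        (HomClass.realize_term (g := (show A →[L] B from f)) (t := t i)).symm
      map_rel' := fun r => Empty.elim r }

/-- The class `C^[κ]` of isomorphic copies of the algebras `A^[κ]` with `A ∈ C`. -/
def matrixClass {L : FirstOrder.Language.{u, 0}} (κ : Type u) (C : AlgClass L) :
    AlgClass (matrixLang L κ) := fun B =>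
  ∃ A : Alg L, C A ∧ Nonempty (matrixAlg κ A ≅ B)

/-! ### The construction `θ_𝓛` -/

/-- A sublanguage of an algebraic language: a set of operation symbols. -/
abbrev Sublang (L : FirstOrder.Language.{u, 0}) := ∀ n, Set (L.Functions n)

/-- A sublanguage as a language in its own right. -/
def Sublang.lang {L : FirstOrder.Language.{u, 0}} (S : Sublang L) : FirstOrder.Language.{u, 0} :=
  ⟨fun n => S n, fun _ => Empty⟩

section Theta

variable {L : FirstOrder.Language.{u, 0}}

/-- `θ` is compatible with `S` in `C`: for every `n`-ary `f ∈ S`,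
`θ(x_1) ∪ … ∪ θ(x_n) ⊨_C θ(f(x_1, …, x_n))`. -/
def Compatible (C : AlgClass L) (θ : Set (Equation L Unit)) (S : Sublang L) : Prop :=
  ∀ (n : ℕ), ∀ f ∈ S n, ∀ e ∈ substEqs θ (fun _ => Term.func f fun m : Fin n => Term.var m),
    Conseq C (⋃ m : Fin n, substEqs θ fun _ => Term.var m) e

/-- The set of solutions of `θ` in `A`. -/
def solutions (θ : Set (Equation L Unit)) (A : Alg L) : Set A :=
  {a | ∀ e ∈ θ, Sat A (fun _ => a) e}

theorem solutions_closed {C : AlgClass L} {θ : Set (Equation L Unit)} {S : Sublang L}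
    (hc : Compatible C θ S) {A : Alg L} (hA : C A) {n : ℕ} {f : L.Functions n} (hf : f ∈ S n)
    (x : Fin n → solutions θ A) :
    Structure.funMap f (fun i => (x i : A)) ∈ solutions θ A := by
  intro e he
  have key := hc n f hf _ ⟨e, he, rfl⟩ A hA (fun i => (x i : A)) (by
    intro p hp
    obtain ⟨m, q, hq, rfl⟩ := Set.mem_iUnion.mp hp
    simpa [Sat, substEq, Term.realize_subst] using (x m).2 q hq)
  simpa [Sat, substEq, Term.realize_subst] using key

/-- The algebra `θ_S(A)` of type `S`: the solutions of `θ` in `A` with the restrictions of the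
operations in `S`. -/
def thetaAlg {C : AlgClass L} {θ : Set (Equation L Unit)} {S : Sublang L}
    (hc : Compatible C θ S) (A : C.FullSubcategory) : Alg S.lang where
  carrier := solutions θ A.obj
  str :=
    { funMap := fun f x => ⟨_, solutions_closed hc A.property f.2 x⟩
      RelMap := fun r _ => Empty.elim r }

theorem map_solutions {θ : Set (Equation L Unit)} {A B : Alg L} (f : A →[L] B) {a : A}
    (ha : a ∈ solutions θ A) : f a ∈ solutions θ B := by
  intro e he
  have h := congrArg f (ha e he)
  rw [← HomClass.realize_term, ← HomClass.realize_term] at h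
  exact h

/-- The functor `θ_S` on the class `C`; homomorphisms are restricted to solutions. -/
def thetaFunctor {C : AlgClass L} {θ : Set (Equation L Unit)} {S : Sublang L}
    (hc : Compatible C θ S) : C.FullSubcategory ⥤ Alg S.lang where
  obj A := thetaAlg hc A
  map {A B} f :=
    { toFun := fun a => ⟨(show A.obj →[L] B.obj from f.hom) a.1, map_solutions _ a.2⟩
      map_fun' := fun g x =>
        Subtype.ext ((show A.obj →[L] B.obj from f.hom).map_fun g.1 fun i => (x i).1)
      map_rel' := fun r => Empty.elim r }

end Theta

/-! ### Translations -/

section Translations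

variable {LX LY : FirstOrder.Language.{u, 0}}

/-- A `κ`-translation of `LX` into `LY`: an arity preserving map from `LX` to `LY^κ`. -/
abbrev Translation (LX LY : FirstOrder.Language.{u, 0}) (κ : Type u) :=
  ∀ n, LX.Functions n → (matrixLang LY κ).Functions n

variable {κ : Type u}

/-- The extension `τ_*` of a translation to terms; the variable `x^i_j` is `(i, j)`. -/
def Translation.onTerm (τ : Translation LX LY κ) {V : Type v} :
    LX.Term V → κ → LY.Term (κ × V)
  | Term.var j => fun i => Term.var (i, j)
  | Term.func (l := n) ψ ts => fun i =>
      Term.subst (α := κ × Fin n) (τ n ψ i) fun p => Translation.onTerm τ (ts p.2) p.1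

/-- The lifting `τ^*` of a translation to sets of equations. -/
def Translation.onEqs (τ : Translation LX LY κ) {V : Type v} (Φ : Set (Equation LX V)) :
    Set (Equation LY (κ × V)) :=
  {e | ∃ p ∈ Φ, ∃ i : κ, e = (τ.onTerm p.1 i, τ.onTerm p.2 i)}

/-- `Θ(x⃗_j)`, where `x⃗_j` is the sequence of the variables `x^i_j`. -/
def contextAt (Θ : Set (Equation LY κ)) {V : Type v} (j : V) : Set (Equation LY (κ × V)) :=
  substEqs Θ fun i => Term.var (i, j)

/-- `⟨τ, Θ⟩` is a contextual `κ`-translation of `⊨_X` into `⊨_Y`. -/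
structure IsContextual (X : AlgClass LX) (Y : AlgClass LY) (τ : Translation LX LY κ)
    (Θ : Set (Equation LY κ)) : Prop where
  consequence : ∀ (V : Type u) (Φ : Set (Equation LX V)) (e : Equation LX V), Conseq X Φ e →
    ∀ e₁ ∈ τ.onEqs {e}, Conseq Y (τ.onEqs Φ ∪ ⋃ j : V, contextAt Θ j) e₁
  context : ∀ (n : ℕ) (ψ : LX.Functions n),
    ∀ e ∈ substEqs Θ (τ.onTerm (Term.func ψ fun m : Fin n => Term.var m)),
      Conseq Y (⋃ m : Fin n, contextAt Θ m) e

/-- Non-triviality of a contextual translation: if `Y ⊨ Θ(φ⃗)` for some `κ`-sequence `φ⃗` of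
closed terms, then `Θ(x⃗) ∪ Θ(y⃗) ⊭_Y x^i ≈ y^i` for some `i`. -/
def IsNontrivialContext (Y : AlgClass LY) (Θ : Set (Equation LY κ)) : Prop :=
  (∃ φ : κ → LY.Term Empty, ∀ e ∈ substEqs Θ φ, Conseq Y ∅ e) →
    ∃ i : κ, ¬ Conseq Y (contextAt Θ (0 : Fin 2) ∪ contextAt Θ (1 : Fin 2))
      (Term.var (i, 0), Term.var (i, 1))

/-- The sublanguage `𝓛 = {τ(ψ) : ψ ∈ LX}` of `LY^κ`. -/
def Translation.image (τ : Translation LX LY κ) : Sublang (matrixLang LY κ) :=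
  fun n => Set.range (τ n)

/-- A term of `LY` in variables `κ` gives the constant `κ`-sequence with this value, a unary
operation of `LY^κ`, here applied to the only variable. -/
def constSeq (t : LY.Term κ) : (matrixLang LY κ).Term Unit :=
  Term.func (L := matrixLang LY κ) (l := 1)
    (fun _ : κ => (t.relabel fun i => (i, (0 : Fin 1)))) fun _ => Term.var ()

/-- The set `θ = {ε⃗ ≈ δ⃗ : ε ≈ δ ∈ Θ}` of equations in one variable of the language `LY^κ`. -/
def constContext (Θ : Set (Equation LY κ)) : Set (Equation (matrixLang LY κ) Unit) :=
  (fun e => (constSeq e.1, constSeq e.2)) '' Θ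

/-- Algebras of type `𝓛 = {τ(ψ) : ψ ∈ LX}` regarded as algebras of type `LX`, the symbol `ψ`
being interpreted as `τ(ψ)`. -/
def imageReduct [LX.IsAlgebraic] (τ : Translation LX LY κ) : Alg τ.image.lang ⥤ Alg LX where
  obj A :=
    { carrier := A
      str :=
        { funMap := fun {n} ψ x =>
            Structure.funMap (L := τ.image.lang) (⟨τ n ψ, ψ, rfl⟩ : Set.range (τ n)) x
          RelMap := fun r _ => isEmptyElim r } }
  map {A B} f :=
    { toFun := (show A →[τ.image.lang] B from f)
      map_fun' := fun {n} ψ x => (show A →[τ.image.lang] B from f).map_fun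
        (show τ.image.lang.Functions n from (⟨τ n ψ, ψ, rfl⟩ : Set.range (τ n))) x
      map_rel' := fun r => isEmptyElim r }

open Classical in
/-- The class `K`: it is `Q(Y^[κ])` if `X` and `Y` are quasi-varieties and the `Y`-congruence of
`Tm_Y(κ)` generated by `Θ` is finitely generated, and `GQ_lam(Y^[κ])` otherwise. -/
noncomputable def classK (X : AlgClass LX) (Y : AlgClass LY) (Θ : Set (Equation LY κ))
    (lam : Cardinal.{u}) : AlgClass (matrixLang LY κ) :=
  if IsQuasiVariety X ∧ IsQuasiVariety Y ∧ CgFinitelyGenerated Y Θ then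
    Q (matrixClass κ Y)
  else
    GQ lam (matrixClass κ Y)

end Translations

/-- The functor `[κ] : Y ⥤ K`, for a class `K` that contains all `A^[κ]` with `A ∈ Y`. -/
def powerTo {LY : FirstOrder.Language.{u, 0}} {κ : Type u} {Y : AlgClass LY}
    {K : AlgClass (matrixLang LY κ)} (hK : ∀ A : Y.FullSubcategory, K (matrixAlg κ A.obj)) :
    Y.FullSubcategory ⥤ K.FullSubcategory :=
  K.lift (Y.ι ⋙ matrixPower LY κ) hK

/-- The functor `θ_𝓛 : K ⥤ X`, where `𝓛` is the image of `τ`, for a set `θ` of equations that is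
compatible with `𝓛` in `K` and such that all algebras `θ_𝓛(B)` with `B ∈ K` belong to `X`. -/
def thetaTo {LX LY : FirstOrder.Language.{u, 0}} [LX.IsAlgebraic] {κ : Type u} {X : AlgClass LX}
    {τ : Translation LX LY κ} {K : AlgClass (matrixLang LY κ)}
    {θ : Set (Equation (matrixLang LY κ) Unit)} (hc : Compatible K θ τ.image)
    (hθ : ∀ B : K.FullSubcategory, X ((imageReduct τ).obj (thetaAlg hc B))) :
    K.FullSubcategory ⥤ X.FullSubcategory :=
  X.lift (thetaFunctor hc ⋙ imageReduct τ) hθ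

/-- A functor is trivial (as a right adjoint) if it sends every object to a terminal object. -/
def IsTrivialRight {C D : Type*} [Category C] [Category D] (G : C ⥤ D) : Prop :=
  ∀ A : C, Nonempty (Limits.IsTerminal (G.obj A))

end CtxTrans

open CtxTrans

namespace CtxTrans

/-! ### Satisfaction, homomorphisms and substitution -/

section Satisfaction

variable {L : FirstOrder.Language.{u, 0}}

/-! Both left adjoints come from generators and relations. A homomorphism `B → A^[κ]` is the same as
an assignment `κ × B → A` satisfying suitable equations, and a homomorphism `A → θ_𝓛(B)` is the same
as an assignment `A → B` satisfying suitable equations. The algebra presented by these equations is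
therefore the value of the left adjoint at the given object. Such an algebra exists in every class
defined by generalized quasi-equations (`presented_mem`), hence in `Y` and in `K`.

The functors are well defined because evaluating a translated term in `A^[κ]` is evaluating `τ_*` of
it in `A`, coordinate by coordinate (`Translation.realize_matrixAlg`). The two conditions on a
contextual translation thus become implications valid in `Y^[κ]`, and these must pass to `K`. For
`GQ_lam` this needs few variables: `U_lam(X) = X` reduces membership in `X` to `lam`-generated
subalgebras (`theta_mem_of_U`). For `Q` it needs finitely many premises: compactness replaces `Θ` by
a finite subset (`exists_finite_of_cgFinitelyGenerated`), and each axiom of `X` is written in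
finitely many variables (`theta_mem_of_Q`).

If the composite were trivial, `Θ` would have exactly one solution in each member of `Y`. In the
algebra on no generators this solution consists of closed terms, so non-triviality of the context
applies and contradicts uniqueness. -/

theorem subst_var_eq {V : Type*} (t : L.Term V) : t.subst Term.var = t := by
  induction t with
  | var v => rfl
  | func f ts ih => exact congrArg (Term.func f) (funext ih)

theorem sat_substEq {V W : Type*} {A : Alg L} {h : W → A} {σ : V → L.Term W} {e : Equation L V} :
    Sat A h (substEq σ e) ↔ Sat A (fun v => (σ v).realize h) e := by
  simp [Sat, substEq, Term.realize_subst]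

theorem Sat.map {V : Type*} {A B : Alg L} (f : A →[L] B) {h : V → A} {e : Equation L V}
    (he : Sat A h e) : Sat B (f ∘ h) e := by
  unfold Sat at *
  rw [HomClass.realize_term, HomClass.realize_term, he]

theorem Sat.of_map {V : Type*} {A B : Alg L} (f : A →[L] B) (hf : Function.Injective f)
    {h : V → A} {e : Equation L V} (he : Sat B (f ∘ h) e) : Sat A h e := by
  unfold Sat at *
  rw [HomClass.realize_term, HomClass.realize_term] at he
  exact hf he

theorem Conseq.of_mem {C : AlgClass L} {V : Type v} {Φ : Set (Equation L V)} {e : Equation L V}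
    (he : e ∈ Φ) : Conseq C Φ e := fun _ _ _ h => h e he

theorem Conseq.cut {C : AlgClass L} {V : Type v} {Φ Ψ : Set (Equation L V)} {e : Equation L V}
    (he : Conseq C Φ e) (hΨ : ∀ p ∈ Φ, Conseq C Ψ p) : Conseq C Ψ e :=
  fun A hA h hs => he A hA h fun p hp => hΨ p hp A hA h hs

theorem Conseq.mono {C : AlgClass L} {V : Type v} {Φ Ψ : Set (Equation L V)} {e : Equation L V}
    (he : Conseq C Φ e) (hΨ : Φ ⊆ Ψ) : Conseq C Ψ e :=
  he.cut fun _ hp => Conseq.of_mem (hΨ hp)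

theorem Conseq.subst {C : AlgClass L} {V W : Type*} {Φ : Set (Equation L V)} {e : Equation L V}
    (he : Conseq C Φ e) (σ : V → L.Term W) : Conseq C (substEqs Φ σ) (substEq σ e) :=
  fun A hA _ hs => sat_substEq.2 <| he A hA _ fun p hp => sat_substEq.1 (hs _ ⟨p, hp, rfl⟩)

theorem GenQuasiEq.Holds.of_injective {V : Type v} {Φ : GenQuasiEq L V} {A B : Alg L}
    (hB : Φ.Holds B) (f : A →[L] B) (hf : Function.Injective f) : Φ.Holds A :=
  fun _ hs => Sat.of_map f hf (hB _ fun p hp => Sat.map f (hs p hp))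

/-- A generalized quasi-equation with its variables renamed. -/
def GenQuasiEq.rename {V W : Type*} (f : V → W) (Φ : GenQuasiEq L V) : GenQuasiEq L W :=
  ⟨substEqs Φ.premises fun v => Term.var (f v), substEq (fun v => Term.var (f v)) Φ.conclusion⟩

theorem GenQuasiEq.Holds.rename {V W : Type*} {Φ : GenQuasiEq L V} {A : Alg L} (hA : Φ.Holds A)
    (f : V → W) : (Φ.rename f).Holds A :=
  fun _ hs => sat_substEq.2 <| hA _ fun p hp => sat_substEq.1 (hs _ ⟨p, hp, rfl⟩)

theorem GenQuasiEq.Holds.of_rename {V W : Type*} {Φ : GenQuasiEq L V} {A : Alg L} {f : V → W}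
    (hf : Function.Injective f) (hA : (Φ.rename f).Holds A) : Φ.Holds A := by
  intro h hs
  -- Variables outside the range of `f` need a default value although `A` may be empty; under a
  -- given `h`, the value of a term in the conclusion provides one.
  have key : (fun v => (Term.var (f v) : L.Term W).realize
      (Function.extend f h fun _ => Φ.conclusion.1.realize h)) = h := by
    funext v
    simp [hf.extend_apply]
  have := hA (Function.extend f h fun _ => Φ.conclusion.1.realize h) (by
    rintro _ ⟨p, hp, rfl⟩
    rw [sat_substEq, key]
    exact hs p hp)
  rwa [GenQuasiEq.rename, sat_substEq, key] at this

end Satisfaction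

/-! ### Implicational classes -/

section Implicational

variable {L : FirstOrder.Language.{u, 0}}

/-- A class is implicational if it contains every model of the generalized quasi-equations that
are valid in it. -/
def IsImplicational (C : AlgClass L) : Prop :=
  ∀ A, (∀ (V : Type u) (Φ : GenQuasiEq L V), (∀ B, C B → Φ.Holds B) → Φ.Holds A) → C A

theorem IsGenQuasiVariety.isImplicational {C : AlgClass L} (hC : IsGenQuasiVariety C) :
    IsImplicational C := by
  obtain ⟨V, _, Ax, hAx⟩ := hC
  exact fun A hA => (hAx A).2 fun Φ hΦ => hA V Φ fun B hB => (hAx B).1 hB Φ hΦ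

theorem GQ.isImplicational (lam : Cardinal.{u}) (C : AlgClass L) : IsImplicational (GQ lam C) :=
  fun _ hA V hV Φ hΦ => hA V Φ fun _ hB => hB V hV Φ hΦ

theorem Q.isImplicational (C : AlgClass L) : IsImplicational (Q C) := by
  intro A hA Φ hfin hΦ
  exact .of_rename ULift.up_injective <|
    hA (ULift ℕ) (Φ.rename ULift.up) fun B hB => (hB Φ hfin hΦ).rename _

theorem IsImplicational.of_injective {C : AlgClass L} (hC : IsImplicational C) {A B : Alg L}
    (hB : C B) (f : A →[L] B) (hf : Function.Injective f) : C A :=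
  hC A fun _ _ hΦ => (hΦ B hB).of_injective f hf

theorem IsImplicational.of_subsingleton {C : AlgClass L} (hC : IsImplicational C) (A : Alg L)
    [Subsingleton A] : C A :=
  hC A fun _ _ _ _ _ => Subsingleton.elim (α := A) _ _

/-- Countably many variables suffice for the quasi-equations valid in `Q C`. -/
theorem Conseq.to_Q {C : AlgClass L} {V : Type v} [Countable V] {Φ : Set (Equation L V)}
    {e : Equation L V} (hfin : Φ.Finite) (he : Conseq C Φ e) : Conseq (Q C) Φ e := by
  intro A hA
  obtain ⟨f, hf⟩ := exists_injective_nat V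
  refine GenQuasiEq.Holds.of_rename (Φ := ⟨Φ, e⟩) hf (hA _ (hfin.image _) fun B hB => ?_)
  exact GenQuasiEq.Holds.rename (Φ := ⟨Φ, e⟩) (he B hB) f

theorem Conseq.to_GQ {C : AlgClass L} {lam : Cardinal.{u}} {V : Type u} (hV : #V ≤ lam)
    {Φ : Set (Equation L V)} {e : Equation L V} (he : Conseq C Φ e) : Conseq (GQ lam C) Φ e :=
  fun _ hA => hA V hV ⟨Φ, e⟩ he

theorem Conseq.to_GQ_of_countable {C : AlgClass L} {lam : Cardinal.{u}} (hlam : ℵ₀ ≤ lam)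
    {V : Type} [Countable V] {Φ : Set (Equation L V)} {e : Equation L V} (he : Conseq C Φ e) :
    Conseq (GQ lam C) Φ e := by
  intro A hA
  refine GenQuasiEq.Holds.of_rename (Φ := ⟨Φ, e⟩) (f := ULift.up.{u}) ULift.up_injective
    (hA _ (Cardinal.mk_le_aleph0.trans hlam) _ fun B hB => ?_)
  exact GenQuasiEq.Holds.rename (Φ := ⟨Φ, e⟩) (he B hB) _

theorem le_Q (C : AlgClass L) : C ≤ Q C := fun A hA _ _ hΦ => hΦ A hA

theorem le_GQ (lam : Cardinal.{u}) (C : AlgClass L) : C ≤ GQ lam C :=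
  fun A hA _ _ _ hΦ => hΦ A hA

/-- The inclusion of a substructure into an algebra. -/
def subtypeHom (A : Alg L) (S : L.Substructure A) : (⟨S⟩ : Alg L) →[L] A :=
  S.subtype.toHom

theorem subtypeHom_injective (A : Alg L) (S : L.Substructure A) :
    Function.Injective (subtypeHom A S) := Subtype.val_injective

/-- Take `lam = #V` for the variables `V` of an axiomatization: the values of an assignment generate
a `lam`-generated subalgebra, and an axiom can be tested there. -/
theorem IsGenQuasiVariety.exists_U_eq {C : AlgClass L} (hC : IsGenQuasiVariety C) :
    ∃ lam : Cardinal.{u}, ℵ₀ ≤ lam ∧ U lam C = C := by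
  have himp := hC.isImplicational
  obtain ⟨V, _, Ax, hAx⟩ := hC
  refine ⟨#V, Cardinal.aleph0_le_mk V, ?_⟩
  funext A
  refine propext ⟨fun hA => (hAx A).2 fun Φ hΦ h hs => ?_, fun hA s _ =>
    himp.of_injective hA (subtypeHom A _) (subtypeHom_injective A _)⟩
  have hsub := (hAx _).1 (hA (Set.range h) Cardinal.mk_range_le) Φ hΦ
  let S := Substructure.closure L (Set.range h)
  let h' : V → (⟨S⟩ : Alg L) := fun v => ⟨h v, Substructure.subset_closure ⟨v, rfl⟩⟩
  exact Sat.map (subtypeHom A S) (hsub h' fun p hp =>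
    Sat.of_map (subtypeHom A S) (subtypeHom_injective A S) (hs p hp))

end Implicational

/-! ### Quotients of term algebras and presented algebras -/

section Presented

variable {L : FirstOrder.Language.{u, 0}}

theorem quotAlg_funMap {A : Alg L} {r : Setoid A} (hr : IsCongruence A r) {n : ℕ}
    (f : L.Functions n) (x : Fin n → A) :
    Structure.funMap (M := quotAlg A r) f (fun i => (Quotient.mk r (x i) : Quotient r)) =
      (Quotient.mk r (Structure.funMap f x) : Quotient r) :=
  Quotient.sound (hr n f _ _ fun i => Quotient.mk_out (x i))

/-- A homomorphism whose kernel contains a congruence factors through the quotient. -/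
def quotLift [L.IsAlgebraic] {A B : Alg L} {r : Setoid A} (f : A →[L] B)
    (hf : ∀ x y, r x y → f x = f y) : quotAlg A r →[L] B where
  toFun := Quotient.lift f hf
  map_fun' {n} g x := by
    obtain ⟨y, rfl⟩ : ∃ y : Fin n → A, x = fun i => Quotient.mk r (y i) :=
      ⟨fun i => (x i).out, funext fun i => ((x i).out_eq).symm⟩
    refine (f.map_fun g _).trans (congrArg _ (funext fun i => ?_))
    exact hf _ _ (Quotient.mk_out (y i))
  map_rel' r := isEmptyElim r

/-- The class of a term in a quotient of the term algebra. -/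
def termClass {W : Type u} (r : Setoid (termAlg L W)) (t : L.Term W) : quotAlg (termAlg L W) r :=
  Quotient.mk r t

theorem termClass_surjective {W : Type u} (r : Setoid (termAlg L W)) :
    Function.Surjective (termClass r) := Quotient.exists_rep

theorem realize_termClass {W : Type u} {V : Type*} {r : Setoid (termAlg L W)}
    (hr : IsCongruence (termAlg L W) r) (σ : V → L.Term W) (t : L.Term V) :
    t.realize (fun v => termClass r (σ v)) = termClass r (t.subst σ) := by
  induction t with
  | var v => rfl
  | func f ts ih =>
    rw [Term.realize_func]
    simp only [ih]
    exact quotAlg_funMap (A := termAlg L W) hr f fun i => (ts i).subst σ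

theorem sat_termClass {W : Type u} {V : Type*} {r : Setoid (termAlg L W)}
    (hr : IsCongruence (termAlg L W) r) (σ : V → L.Term W) (e : Equation L V) :
    Sat (quotAlg (termAlg L W) r) (fun v => termClass r (σ v)) e ↔
      r (e.1.subst σ) (e.2.subst σ) := by
  rw [Sat, realize_termClass hr, realize_termClass hr]
  exact Quotient.eq

/-- Assignments into a quotient of a term algebra lift to substitutions, so validity becomes a
closure property of the congruence `r`. -/
theorem holds_quot_termAlg {W : Type u} {V : Type*} {r : Setoid (termAlg L W)}
    (hr : IsCongruence (termAlg L W) r) (Φ : GenQuasiEq L V)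
    (hΦ : ∀ σ : V → L.Term W, (∀ p ∈ Φ.premises, r (p.1.subst σ) (p.2.subst σ)) →
      r (Φ.conclusion.1.subst σ) (Φ.conclusion.2.subst σ)) :
    Φ.Holds (quotAlg (termAlg L W) r) := by
  intro h hs
  obtain ⟨σ, rfl⟩ := (termClass_surjective r).comp_left h
  exact (sat_termClass hr σ _).2 <| hΦ σ fun p hp => (sat_termClass hr σ p).1 (hs p hp)

/-- Two terms are identified when they are equal in `C` as a consequence of `R`. -/
def conseqSetoid (C : AlgClass L) {W : Type u} (R : Set (Equation L W)) :
    Setoid (termAlg L W) where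
  r s t := Conseq C R ((s, t) : Equation L W)
  iseqv :=
    { refl := fun _ _ _ _ _ => rfl
      symm := fun h A hA a ha => (h A hA a ha).symm
      trans := fun h k A hA a ha => (h A hA a ha).trans (k A hA a ha) }

theorem isCongruence_conseqSetoid (C : AlgClass L) {W : Type u} (R : Set (Equation L W)) :
    IsCongruence (termAlg L W) (conseqSetoid C R) := by
  intro n f x y hxy A hA h hs
  exact congrArg (Structure.funMap f) (funext fun i => hxy i A hA h hs)

/-- The algebra presented by the generators `W` and the relations `R` relative to `C`. -/
noncomputable def presented (C : AlgClass L) {W : Type u} (R : Set (Equation L W)) : Alg L :=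
  quotAlg (termAlg L W) (conseqSetoid C R)

/-- The generators of a presented algebra. -/
noncomputable def presentedVar (C : AlgClass L) {W : Type u} (R : Set (Equation L W)) (w : W) :
    presented C R :=
  termClass (conseqSetoid C R) (Term.var w)

theorem presented_mem {C : AlgClass L} (hC : IsImplicational C) {W : Type u}
    (R : Set (Equation L W)) : C (presented C R) := by
  refine hC _ fun V Φ hΦ => holds_quot_termAlg (isCongruence_conseqSetoid C R) Φ fun σ hs => ?_
  refine Conseq.cut (Conseq.subst (C := C) (Φ := Φ.premises) (e := Φ.conclusion) hΦ σ) ?_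
  rintro _ ⟨p, hp, rfl⟩
  exact hs p hp

theorem realize_presentedVar (C : AlgClass L) {W : Type u} (R : Set (Equation L W))
    (t : L.Term W) : t.realize (presentedVar C R) = termClass (conseqSetoid C R) t :=
  (realize_termClass (isCongruence_conseqSetoid C R) Term.var t).trans
    (congrArg _ (subst_var_eq t))

theorem sat_presentedVar {C : AlgClass L} {W : Type u} {R : Set (Equation L W)}
    {e : Equation L W} : Sat (presented C R) (presentedVar C R) e ↔ Conseq C R e := by
  rw [Sat, realize_presentedVar, realize_presentedVar]
  exact Quotient.eq

/-- Evaluation of terms at an assignment. -/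
def evalHom [L.IsAlgebraic] {W : Type u} (A : Alg L) (h : W → A) : termAlg L W →[L] A where
  toFun t := Term.realize h (show L.Term W from t)
  map_fun' _ _ := rfl
  map_rel' r := isEmptyElim r

/-- The homomorphism from a presented algebra given by an assignment that satisfies the
relations. -/
def presentedLift [L.IsAlgebraic] {C : AlgClass L} {W : Type u} {R : Set (Equation L W)}
    {A : Alg L} (hA : C A) (h : W → A) (hs : ∀ p ∈ R, Sat A h p) : presented C R →[L] A :=
  quotLift (evalHom A h) fun _ _ hxy => hxy A hA h hs

theorem presented_hom_ext {C : AlgClass L} {W : Type u} {R : Set (Equation L W)} {A : Alg L}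
    {f g : presented C R →[L] A} (hfg : ∀ w, f (presentedVar C R w) = g (presentedVar C R w)) :
    f = g := by
  ext x
  obtain ⟨t, rfl⟩ : ∃ t : L.Term W, t.realize (presentedVar C R) = x := by
    obtain ⟨t, rfl⟩ := termClass_surjective _ x
    exact ⟨t, realize_presentedVar C R t⟩
  rw [← HomClass.realize_term, ← HomClass.realize_term]
  exact congrArg (fun h => Term.realize h t) (funext hfg)

end Presented

/-! ### Finitarity of quasi-varieties -/

section Finitary

variable {L : FirstOrder.Language.{u, 0}}

/-- Two terms are identified when they are equal in `C` as a consequence of finitely many of the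
equations in `R`. -/
def finConseqSetoid (C : AlgClass L) {W : Type u} (R : Set (Equation L W)) :
    Setoid (termAlg L W) where
  r s t := ∃ R₀ ⊆ R, R₀.Finite ∧ Conseq C R₀ ((s, t) : Equation L W)
  iseqv :=
    { refl := fun _ => ⟨∅, R.empty_subset, Set.finite_empty, fun _ _ _ _ => rfl⟩
      symm := fun ⟨R₀, hR₀, hfin, h⟩ => ⟨R₀, hR₀, hfin, fun A hA a ha => (h A hA a ha).symm⟩
      trans := fun ⟨R₀, hR₀, hfin, h⟩ ⟨R₁, hR₁, hfin₁, h₁⟩ =>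
        ⟨R₀ ∪ R₁, Set.union_subset hR₀ hR₁, hfin.union hfin₁, fun A hA a ha =>
          (h.mono Set.subset_union_left A hA a ha).trans
            (h₁.mono Set.subset_union_right A hA a ha)⟩ }

/-- Finitely many equations that follow from finite subsets of `R` follow from a common one. -/
theorem exists_finite_conseq {C : AlgClass L} {W : Type v} {R P : Set (Equation L W)}
    (hP : P.Finite) (h : ∀ p ∈ P, ∃ R₀ ⊆ R, R₀.Finite ∧ Conseq C R₀ p) :
    ∃ R₀ ⊆ R, R₀.Finite ∧ ∀ p ∈ P, Conseq C R₀ p := by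
  choose! R₀ hR₀ hfin hc using h
  exact ⟨⋃ p ∈ P, R₀ p, Set.iUnion₂_subset hR₀, hP.biUnion hfin,
    fun p hp => (hc p hp).mono (Set.subset_biUnion_of_mem hp)⟩

theorem isCongruence_finConseqSetoid (C : AlgClass L) {W : Type u} (R : Set (Equation L W)) :
    IsCongruence (termAlg L W) (finConseqSetoid C R) := by
  intro n f x y hxy
  obtain ⟨R₀, hR₀, hfin, hc⟩ := exists_finite_conseq (C := C) (R := R)
    (Set.finite_range fun i => ((x i, y i) : Equation L W)) (by rintro _ ⟨i, rfl⟩; exact hxy i)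
  exact ⟨R₀, hR₀, hfin, isCongruence_conseqSetoid C R₀ n f x y fun i => hc _ ⟨i, rfl⟩⟩

/-- Compactness without ultraproducts. Since axioms have finitely many premises, the term algebra
modulo consequence from finite subsets of `R` is already a member of `C`; its generators satisfy
`R`, hence `e`. -/
theorem IsQuasiVariety.exists_finite_subset {C : AlgClass L} (hC : IsQuasiVariety C) {W : Type u}
    {R : Set (Equation L W)} {e : Equation L W} (he : Conseq C R e) :
    ∃ R₀ ⊆ R, R₀.Finite ∧ Conseq C R₀ e := by
  obtain ⟨Ax, hAxfin, hAx⟩ := hC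
  have hr := isCongruence_finConseqSetoid C R
  have hmem : C (quotAlg (termAlg L W) (finConseqSetoid C R)) := by
    refine (hAx _).2 fun Φ hΦ => holds_quot_termAlg hr Φ fun σ hs => ?_
    obtain ⟨R₀, hR₀, hfin, hc⟩ := exists_finite_conseq (C := C) (R := R)
      (P := substEqs Φ.premises σ) ((hAxfin Φ hΦ).image _)
      (by rintro _ ⟨p, hp, rfl⟩; exact hs p hp)
    exact ⟨R₀, hR₀, hfin, Conseq.cut (Conseq.subst (C := C) (Φ := Φ.premises)
      (e := Φ.conclusion) (fun A hA => (hAx A).1 hA Φ hΦ) σ) hc⟩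
  have hsat (e : Equation L W) : Sat (quotAlg (termAlg L W) (finConseqSetoid C R))
      (fun w => termClass _ (Term.var w)) e ↔
        ∃ R₀ ⊆ R, R₀.Finite ∧ Conseq C R₀ e := by
    rw [sat_termClass hr, subst_var_eq, subst_var_eq]
    rfl
  exact (hsat e).1 <| he _ hmem _ fun p hp => (hsat p).2
    ⟨{p}, Set.singleton_subset_iff.2 hp, Set.finite_singleton p, Conseq.of_mem rfl⟩

/-- The relation `Cg C A S` is contained in the kernel of every homomorphism from `A` to a member
of `C` whose kernel contains `S`. -/
theorem Cg_le_ker [L.IsAlgebraic] {C : AlgClass L} (hC : IsImplicational C) {A B : Alg L}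
    (hB : C B) (f : A →[L] B) {S : Set (A × A)} (hS : ∀ p ∈ S, f p.1 = f p.2) {x y : A}
    (hxy : Cg C A S x y) : f x = f y := by
  have hcong : IsCongruence A (Setoid.ker f) := fun n g x y h => by
    change f _ = f _
    rw [f.map_fun, f.map_fun]
    exact congrArg _ (funext h)
  refine hxy (Setoid.ker f) ⟨⟨hcong, ?_⟩, hS⟩
  -- The quotient by the kernel embeds in `B`, so the kernel is one of the congruences intersected
  -- in `Cg`.
  refine hC.of_injective hB (quotLift f fun _ _ h => h) fun x y => ?_
  induction x using Quotient.inductionOn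
  induction y using Quotient.inductionOn
  exact fun h => Quotient.sound h

/-- Lift the finite generating set `F` to a set `P` of equations. Each member of `P` follows from
`Θ`, hence from a finite part of it by compactness; conversely `P` entails all of `Θ`. -/
theorem exists_finite_of_cgFinitelyGenerated [L.IsAlgebraic] {C : AlgClass L}
    (hC : IsQuasiVariety C) (hC' : IsImplicational C) {V : Type u} {Θ : Set (Equation L V)}
    (hΘ : CgFinitelyGenerated C Θ) :
    ∃ Θ₀ ⊆ Θ, Θ₀.Finite ∧ ∀ e ∈ Θ, Conseq C Θ₀ e := by
  obtain ⟨F, hF, hFΘ⟩ := hΘ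
  let mk : Equation L V → freeAlg C V × freeAlg C V := fun e =>
    (Quotient.mk (freeSetoid C V) e.1, Quotient.mk (freeSetoid C V) e.2)
  have hmk : Function.Surjective mk := fun ⟨x, y⟩ => by
    obtain ⟨s, rfl⟩ := Quotient.exists_rep x
    obtain ⟨t, rfl⟩ := Quotient.exists_rep y
    exact ⟨(s, t), rfl⟩
  let eval (A : Alg L) (hA : C A) (h : V → A) : freeAlg C V →[L] A :=
    quotLift (r := freeSetoid C V) (evalHom A h) fun _ _ hxy => hxy A hA h (by simp)
  have hCg {R : Set (Equation L V)} {S : Set (freeAlg C V × freeAlg C V)} (hS : S ⊆ mk '' R)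
      {e : Equation L V} (he : Cg C (freeAlg C V) S (mk e).1 (mk e).2) : Conseq C R e := by
    refine fun A hA h hs => Cg_le_ker hC' hA (eval A hA h) (fun p hp => ?_) he
    obtain ⟨q, hq, rfl⟩ := hS hp
    exact hs q hq
  have hgen {S : Set (freeAlg C V × freeAlg C V)} {p} (hp : p ∈ S) :
      Cg C (freeAlg C V) S p.1 p.2 := fun r hr => hr.2 p hp
  obtain ⟨P, hP, hPF⟩ : ∃ P : Set (Equation L V), P.Finite ∧ mk '' P = F :=
    ⟨Function.surjInv hmk '' F, hF.image _, by
      simp [Set.image_image, Function.surjInv_eq hmk]⟩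
  obtain ⟨Θ₀, hΘ₀, hfin, hc⟩ := exists_finite_conseq (C := C) (R := Θ) hP fun p hp =>
    hC.exists_finite_subset (hCg (S := eqsInFree C Θ) Set.Subset.rfl
      (hFΘ ▸ hgen (hPF ▸ Set.mem_image_of_mem mk hp)))
  refine ⟨Θ₀, hΘ₀, hfin, fun e he => Conseq.cut (Φ := P) (hCg hPF.ge ?_) hc⟩
  rw [hFΘ]
  exact hgen (S := eqsInFree C Θ) (Set.mem_image_of_mem mk he)

end Finitary

/-! ### Translations as terms of the matrix language -/

section Matrix

variable {LX LY : FirstOrder.Language.{u, 0}} {κ : Type u}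

theorem conseq_matrixClass_iff {Y : AlgClass LY} {V : Type v}
    {Φ : Set (Equation (matrixLang LY κ) V)} {e : Equation (matrixLang LY κ) V} :
    Conseq (matrixClass κ Y) Φ e ↔ ∀ A, Y A → GenQuasiEq.Holds ⟨Φ, e⟩ (matrixAlg κ A) := by
  refine ⟨fun h A hA => h _ ⟨A, hA, ⟨Iso.refl _⟩⟩, fun h B ⟨A, hA, ⟨i⟩⟩ => ?_⟩
  refine GenQuasiEq.Holds.of_injective (Φ := ⟨Φ, e⟩) (h A hA)
    (show B →[matrixLang LY κ] matrixAlg κ A from i.inv) ?_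
  exact Function.LeftInverse.injective (g := (show matrixAlg κ A →[matrixLang LY κ] B from i.hom))
    fun b => congrArg (fun f : B →[matrixLang LY κ] B => f b) i.inv_hom_id

/-- Two constant sequences agree iff their values do; this direction is where `κ > 0` matters, as a
coordinate must be read off. -/
theorem sat_constSeq [Nonempty κ] {A : Alg LY} {a : κ → A} {e : Equation LY κ} :
    Sat (matrixAlg κ A) (fun _ => a) (constSeq e.1, constSeq e.2) ↔ Sat A a e := by
  have key (t : LY.Term κ) (i : κ) :
      (constSeq t).realize (M := matrixAlg κ A) (fun _ => a) i = t.realize a :=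
    Term.realize_relabel
  refine ⟨fun h => ?_, fun h => funext fun i => (key _ i).trans (h.trans (key _ i).symm)⟩
  obtain ⟨i⟩ := ‹Nonempty κ›
  exact (key _ i).symm.trans ((congrFun h i).trans (key _ i))

theorem mem_solutions_matrixAlg [Nonempty κ] {Θ : Set (Equation LY κ)} {A : Alg LY} {a : κ → A} :
    a ∈ solutions (constContext Θ) (matrixAlg κ A) ↔ ∀ e ∈ Θ, Sat A a e := by
  constructor
  · exact fun h e he => sat_constSeq.1 (h _ ⟨e, he, rfl⟩)
  · rintro h _ ⟨e, he, rfl⟩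
    exact sat_constSeq.2 (h e he)

theorem sat_contextAt {Θ : Set (Equation LY κ)} {V : Type v} {j : V} {A : Alg LY}
    {h : κ × V → A} :
    (∀ p ∈ contextAt Θ j, Sat A h p) ↔ ∀ e ∈ Θ, Sat A (fun i => h (i, j)) e := by
  constructor
  · exact fun hs e he => sat_substEq.1 (hs _ ⟨e, he, rfl⟩)
  · rintro hs _ ⟨e, he, rfl⟩
    exact sat_substEq.2 (hs e he)

/-- The context `θ` at the variable `j`. -/
def matrixContextAt (Θ : Set (Equation LY κ)) {V : Type v} (j : V) :
    Set (Equation (matrixLang LY κ) V) :=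
  substEqs (constContext Θ) fun _ => Term.var j

theorem sat_matrixContextAt {Θ : Set (Equation LY κ)} {V : Type v} {j : V}
    {B : Alg (matrixLang LY κ)} {h : V → B} :
    (∀ p ∈ matrixContextAt Θ j, Sat B h p) ↔ h j ∈ solutions (constContext Θ) B := by
  constructor
  · exact fun hs e he => sat_substEq.1 (hs _ ⟨e, he, rfl⟩)
  · rintro hs _ ⟨e, he, rfl⟩
    exact sat_substEq.2 (hs e he)

theorem finite_matrixContextAt {Θ : Set (Equation LY κ)} (hΘ : Θ.Finite) {V : Type v} (j : V) :
    (matrixContextAt Θ j).Finite := (hΘ.image _).image _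

theorem matrixContextAt_mono {Θ₀ Θ : Set (Equation LY κ)} (h : Θ₀ ⊆ Θ) {V : Type v} (j : V) :
    matrixContextAt Θ₀ j ⊆ matrixContextAt Θ j := Set.image_mono (Set.image_mono h)

theorem forall_mem_iUnion {ι α : Type*} {s : ι → Set α} {P : α → Prop} :
    (∀ x ∈ ⋃ i, s i, P x) ↔ ∀ i, ∀ x ∈ s i, P x := by
  simp only [Set.mem_iUnion]
  exact ⟨fun h i x hx => h x ⟨i, hx⟩, fun h x ⟨i, hx⟩ => h i x hx⟩

theorem forall_mem_union {α : Type*} {s t : Set α} {P : α → Prop} :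
    (∀ x ∈ s ∪ t, P x) ↔ (∀ x ∈ s, P x) ∧ ∀ x ∈ t, P x :=
  Set.union_subset_iff (u := {x | P x})

variable [LX.IsAlgebraic]

/-- A translation as a map of languages. -/
def Translation.lhom (τ : Translation LX LY κ) : LX →ᴸ matrixLang LY κ where
  onFunction _ ψ := τ _ ψ
  onRelation _ r := isEmptyElim r

/-- The equation of the matrix language obtained by replacing each `ψ` with `τ(ψ)`. -/
def Translation.onEquation (τ : Translation LX LY κ) {V : Type v} (e : Equation LX V) :
    Equation (matrixLang LY κ) V :=
  (τ.lhom.onTerm e.1, τ.lhom.onTerm e.2)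

/-- Composition of operations in `A^[κ]` is simultaneous substitution of `κ`-tuples, which is
exactly the recursive clause of `τ_*`. -/
theorem Translation.realize_matrixAlg (τ : Translation LX LY κ) {V : Type v} {A : Alg LY}
    (h : V → κ → A) (t : LX.Term V) (i : κ) :
    (τ.lhom.onTerm t).realize (M := matrixAlg κ A) h i =
      (τ.onTerm t i).realize fun p => h p.2 p.1 := by
  induction t generalizing i with
  | var v => rfl
  | func ψ ts ih =>
    refine Eq.trans ?_ Term.realize_subst.symm
    exact congrArg (fun g => Term.realize g (τ _ ψ i)) (funext fun p => ih p.2 p.1)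

theorem Translation.sat_matrixAlg (τ : Translation LX LY κ) {V : Type v} {A : Alg LY}
    {h : V → κ → A} {e : Equation LX V} :
    Sat (matrixAlg κ A) h (τ.onEquation e) ↔
      ∀ i, Sat A (fun p => h p.2 p.1) (τ.onTerm e.1 i, τ.onTerm e.2 i) := by
  simp only [Sat, ← τ.realize_matrixAlg]
  exact funext_iff

/-- The translation of a consequence of `X` in the matrix powers of members of `Y`. -/
theorem IsContextual.conseq_matrixClass [Nonempty κ] {X : AlgClass LX} {Y : AlgClass LY}
    {τ : Translation LX LY κ} {Θ Θ₀ : Set (Equation LY κ)} (hτ : IsContextual X Y τ Θ)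
    (hΘ₀ : ∀ e ∈ Θ, Conseq Y Θ₀ e) {V : Type u} {Φ : Set (Equation LX V)} {e : Equation LX V}
    (he : Conseq X Φ e) :
    Conseq (matrixClass κ Y) (τ.onEquation '' Φ ∪ ⋃ j : V, matrixContextAt Θ₀ j)
      (τ.onEquation e) := by
  refine conseq_matrixClass_iff.2 fun A hA h hs => τ.sat_matrixAlg.2 fun i => ?_
  obtain ⟨hΦ, hctx⟩ := forall_mem_union.1 hs
  refine hτ.consequence V Φ e he _ ⟨e, rfl, i, rfl⟩ A hA _ (forall_mem_union.2 ⟨?_, ?_⟩)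
  · rintro _ ⟨p, hp, i, rfl⟩
    exact τ.sat_matrixAlg.1 (hΦ _ ⟨p, hp, rfl⟩) i
  · refine forall_mem_iUnion.2 fun j => sat_contextAt.2 fun e he => hΘ₀ e he A hA _ ?_
    exact mem_solutions_matrixAlg.1 (sat_matrixContextAt.1 (forall_mem_iUnion.1 hctx j))

/-- The context is preserved by the operations `τ(ψ)` in the matrix powers of members of `Y`. -/
theorem IsContextual.conseq_context [Nonempty κ] {X : AlgClass LX} {Y : AlgClass LY}
    {τ : Translation LX LY κ} {Θ Θ₀ : Set (Equation LY κ)} (hτ : IsContextual X Y τ Θ)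
    (hΘ₀ : ∀ e ∈ Θ, Conseq Y Θ₀ e) {n : ℕ} (ψ : LX.Functions n)
    {e : Equation (matrixLang LY κ) (Fin n)}
    (he : e ∈ substEqs (constContext Θ) fun _ =>
      Term.func (L := matrixLang LY κ) (τ n ψ) fun m : Fin n => Term.var m) :
    Conseq (matrixClass κ Y) (⋃ j : Fin n, matrixContextAt Θ₀ j) e := by
  obtain ⟨_, ⟨e, he, rfl⟩, rfl⟩ := he
  refine conseq_matrixClass_iff.2 fun A hA h hs => sat_substEq.2 <| sat_constSeq.2 ?_
  have key := sat_substEq.1 <| hτ.context n ψ _ ⟨e, he, rfl⟩ A hA (fun p => h p.2 p.1)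
    (forall_mem_iUnion.2 fun j => sat_contextAt.2 fun e he => hΘ₀ e he A hA _
      (mem_solutions_matrixAlg.1 (sat_matrixContextAt.1 (forall_mem_iUnion.1 hs j))))
  exact (congrArg (fun a => Sat A a e) (funext fun i =>
    τ.realize_matrixAlg (A := A) h (Term.func ψ fun m => Term.var m) i)).mpr key

end Matrix

/-! ### The class `K` and the functor `θ_𝓛` -/

section Theta

variable {LX LY : FirstOrder.Language.{u, 0}} [LX.IsAlgebraic] {κ : Type u}

/-- The set `Θ₀` stands for a finite part of `Θ` when `K` is a quasi-variety and for `Θ` itself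
otherwise; `hK` isolates the passage from `Y^[κ]` to `K`. -/
theorem compatible_of_conseq [Nonempty κ] {X : AlgClass LX} {Y : AlgClass LY}
    {τ : Translation LX LY κ} {Θ Θ₀ : Set (Equation LY κ)} (hτ : IsContextual X Y τ Θ)
    (hsub : Θ₀ ⊆ Θ) (hΘ₀ : ∀ e ∈ Θ, Conseq Y Θ₀ e) {K : AlgClass (matrixLang LY κ)}
    (hK : ∀ (n : ℕ) (e : Equation (matrixLang LY κ) (Fin n)),
      Conseq (matrixClass κ Y) (⋃ j : Fin n, matrixContextAt Θ₀ j) e →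
        Conseq K (⋃ j : Fin n, matrixContextAt Θ₀ j) e) :
    Compatible K (constContext Θ) τ.image := by
  rintro n _ ⟨ψ, rfl⟩ e he
  exact (hK n e (hτ.conseq_context hΘ₀ ψ he)).mono
    (Set.iUnion_mono fun j => matrixContextAt_mono hsub j)

variable {τ : Translation LX LY κ} {Θ : Set (Equation LY κ)} {K : AlgClass (matrixLang LY κ)}
  (hc : Compatible K (constContext Θ) τ.image) (B : K.FullSubcategory)

theorem realize_theta {V : Type v} (h : V → (imageReduct τ).obj (thetaAlg hc B))
    (t : LX.Term V) :
    (t.realize h).1 = (τ.lhom.onTerm t).realize fun v => ((h v).1 : B.obj) := by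
  induction t with
  | var v => rfl
  | func ψ ts ih =>
    exact congrArg (Structure.funMap (L := matrixLang LY κ) (M := B.obj) (τ _ ψ)) (funext ih)

theorem sat_theta {V : Type v} {h : V → (imageReduct τ).obj (thetaAlg hc B)}
    {e : Equation LX V} :
    Sat _ h e ↔ Sat B.obj (fun v => ((h v).1 : B.obj)) (τ.onEquation e) := by
  unfold Sat Translation.onEquation
  rw [← realize_theta, ← realize_theta]
  exact Subtype.ext_iff

/-- The context premises cost nothing here, since the elements of `θ_𝓛(B)` are solutions of `θ`. -/
theorem holds_theta {Θ₀ : Set (Equation LY κ)} (hsub : Θ₀ ⊆ Θ) {V : Type v}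
    {Φ : Set (Equation LX V)} {e : Equation LX V}
    (he : Conseq K (τ.onEquation '' Φ ∪ ⋃ j : V, matrixContextAt Θ₀ j) (τ.onEquation e)) :
    GenQuasiEq.Holds ⟨Φ, e⟩ ((imageReduct τ).obj (thetaAlg hc B)) := by
  refine fun h hs => (sat_theta hc B).2 <| he B.obj B.property _ <|
    forall_mem_union.2 ⟨?_, forall_mem_iUnion.2 fun j p hp => ?_⟩
  · rintro _ ⟨p, hp, rfl⟩
    exact (sat_theta hc B).1 (hs p hp)
  · exact (sat_matrixContextAt (h := fun v => ((h v).1 : B.obj))).2 (h j).2 p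
      (matrixContextAt_mono hsub j hp)

/-- An algebra generated by a set `s` belongs to `C` as soon as it satisfies, at the assignment of
the generators, every consequence in `C` of equations that it satisfies there. -/
theorem closure_mem {L : FirstOrder.Language.{u, 0}} {C : AlgClass L} (hC : IsImplicational C)
    (A : Alg L) (s : Set A)
    (h : ∀ (Φ : Set (Equation L s)) (e : Equation L s), Conseq C Φ e →
      (∀ p ∈ Φ, Sat A Subtype.val p) → Sat A Subtype.val e) :
    C ⟨Substructure.closure L s⟩ := by
  refine hC _ fun V Φ hΦ g hs => ?_
  have hgen (v : V) : ∃ t : L.Term s, t.realize Subtype.val = (g v).1 :=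
    Substructure.mem_closure_iff_exists_term.1 (g v).2
  choose σ hσ using hgen
  have hsat (e : Equation L V) : Sat A Subtype.val (substEq σ e) ↔
      Sat (⟨Substructure.closure L s⟩ : Alg L) g e := by
    rw [sat_substEq]
    simp only [hσ]
    exact ⟨Sat.of_map (subtypeHom A _) (subtypeHom_injective A _), Sat.map (subtypeHom A _)⟩
  refine (hsat _).1 <| h _ _ (Conseq.subst (C := C) (Φ := Φ.premises) hΦ σ) ?_
  rintro _ ⟨p, hp, rfl⟩
  exact (hsat p).2 (hs p hp)

theorem realize_congr {L : FirstOrder.Language.{u, 0}} {A : Alg L} {V : Type v} [DecidableEq V]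
    {h g : V → A} (t : L.Term V) (hgh : ∀ v ∈ t.varFinset, h v = g v) :
    t.realize h = t.realize g := by
  induction t with
  | var v => exact hgh v (by simp [Term.varFinset])
  | func f ts ih =>
    refine congrArg (Structure.funMap f) (funext fun i => ih i fun v hv => hgh v ?_)
    exact Finset.mem_biUnion.2 ⟨i, Finset.mem_univ i, hv⟩

/-- The variables of finitely many equations in variables `ℕ` are bounded. -/
theorem exists_var_bound {L : FirstOrder.Language.{u, 0}} {Φ : Set (Equation L ℕ)}
    (hΦ : Φ.Finite) : ∃ N : ℕ, ∀ (A : Alg L) (h g : ℕ → A), (∀ n ≤ N, h n = g n) →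
      ∀ p ∈ Φ, Sat A h p ↔ Sat A g p := by
  obtain ⟨N, hN⟩ := (hΦ.biUnion fun p _ =>
    (p.1.varFinset ∪ p.2.varFinset).finite_toSet).bddAbove
  refine ⟨N, fun A h g hgh p hp => ?_⟩
  have hle (v : ℕ) (hv : v ∈ p.1.varFinset ∪ p.2.varFinset) : h v = g v :=
    hgh v (hN (Set.mem_biUnion hp hv))
  unfold Sat
  rw [realize_congr p.1 fun v hv => hle v (Finset.mem_union_left _ hv),
    realize_congr p.2 fun v hv => hle v (Finset.mem_union_right _ hv)]

/-- Membership is tested on subalgebras with at most `lam` generators. Using the generators as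
variables, the relevant consequences stay within the bound of `GQ lam`. -/
theorem theta_mem_of_U [Nonempty κ] {X : AlgClass LX} {Y : AlgClass LY}
    (hX : IsImplicational X) (hτ : IsContextual X Y τ Θ) {lam : Cardinal.{u}}
    (hlam : U lam X = X) (hK : K ≤ GQ lam (matrixClass κ Y)) :
    X ((imageReduct τ).obj (thetaAlg hc B)) := by
  rw [← hlam]
  refine fun s hs => closure_mem hX _ s fun Φ e he => ?_
  refine holds_theta hc B Set.Subset.rfl ?_ Subtype.val
  exact fun A hA => (hτ.conseq_matrixClass (fun _ => Conseq.of_mem) he).to_GQ hs A (hK A hA)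

theorem theta_mem_of_Q [Nonempty κ] {X : AlgClass LX} {Y : AlgClass LY}
    (hX : IsQuasiVariety X) (hτ : IsContextual X Y τ Θ) {Θ₀ : Set (Equation LY κ)}
    (hsub : Θ₀ ⊆ Θ) (hfin : Θ₀.Finite) (hΘ₀ : ∀ e ∈ Θ, Conseq Y Θ₀ e)
    (hK : K ≤ Q (matrixClass κ Y)) :
    X ((imageReduct τ).obj (thetaAlg hc B)) := by
  obtain ⟨Ax, hAxfin, hAx⟩ := hX
  refine (hAx _).2 fun Φ hΦ h hs => ?_
  obtain ⟨N, hN⟩ := exists_var_bound ((hAxfin Φ hΦ).insert Φ.conclusion)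
  -- A context premise is needed for every variable, so over `ℕ` there could be infinitely many.
  -- Truncation at `N` fixes the variables that occur and leaves only `N + 1`.
  let f : ℕ → ULift.{u} (Fin (N + 1)) := fun n => ⟨⟨min n N, by omega⟩⟩
  have he : Conseq X (Φ.rename f).premises (Φ.rename f).conclusion :=
    fun A hA => ((hAx A).1 hA Φ hΦ).rename f
  have hholds : (Φ.rename f).Holds ((imageReduct τ).obj (thetaAlg hc B)) := by
    refine holds_theta hc B hsub ?_
    exact fun A hA => (hτ.conseq_matrixClass hΘ₀ he).to_Q
      ((((hAxfin Φ hΦ).image _).image _).union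
        (Set.finite_iUnion fun j => finite_matrixContextAt hfin j)) A (hK A hA)
  have hsat (p : Equation LX ℕ) (hp : p ∈ insert Φ.conclusion Φ.premises) :
      Sat _ (fun j : ULift.{u} (Fin (N + 1)) => h j.down) (substEq (fun v => Term.var (f v)) p) ↔
        Sat _ h p := by
    rw [sat_substEq]
    refine hN _ _ _ (fun n hn => ?_) p hp
    simp [f, hn]
  refine (hsat _ (Set.mem_insert _ _)).1 (hholds _ ?_)
  rintro _ ⟨p, hp, rfl⟩
  exact (hsat p (Set.mem_insert_of_mem _ hp)).2 (hs p hp)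

end Theta

/-! ### Left adjoints -/

section Adjoints

theorem isRightAdjoint_of_universal {C D : Type*} [Category C] [Category D] (G : C ⥤ D)
    (h : ∀ B : D, ∃ (P : C) (η : B ⟶ G.obj P), ∀ (A : C) (f : B ⟶ G.obj A),
      ∃! g : P ⟶ A, η ≫ G.map g = f) : G.IsRightAdjoint := by
  rw [isRightAdjoint_iff_hasInitial_structuredArrow]
  intro B
  obtain ⟨P, η, hη⟩ := h B
  choose g hg hu using hη
  exact Limits.IsInitial.hasInitial (X := StructuredArrow.mk η) <|
    Limits.IsInitial.ofUniqueHom (fun A => StructuredArrow.homMk (g A.right A.hom) (hg _ _))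
      fun A m => StructuredArrow.hom_ext _ _ (hu _ _ _ (StructuredArrow.w m))

variable {LX LY : FirstOrder.Language.{u, 0}} {κ : Type u}

/-- Relations on the generators `κ × B` such that the assignments in `A` satisfying them are the
homomorphisms from `B` to the matrix power of `A`. -/
def powerRelations (B : Alg (matrixLang LY κ)) : Set (Equation LY (κ × B)) :=
  {e | ∃ (n : ℕ) (t : (matrixLang LY κ).Functions n) (b : Fin n → B) (i : κ),
    e = (Term.var (i, Structure.funMap t b),
      Term.relabel (fun p : κ × Fin n => (p.1, b p.2)) (t i))}

theorem sat_powerRelations {B : Alg (matrixLang LY κ)} {A : Alg LY} {h : κ × B → A} :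
    (∀ p ∈ powerRelations B, Sat A h p) ↔
      ∀ (n : ℕ) (t : (matrixLang LY κ).Functions n) (b : Fin n → B),
        (fun i => h (i, Structure.funMap t b)) =
          Structure.funMap (M := matrixAlg κ A) t fun m i => h (i, b m) := by
  constructor
  · intro hs n t b
    funext i
    exact (hs _ ⟨n, t, b, i, rfl⟩).trans Term.realize_relabel
  · rintro hs _ ⟨n, t, b, i, rfl⟩
    exact (congrFun (hs n t b) i).trans Term.realize_relabel.symm

/-- The unit sends `b` to the `κ`-sequence of generators `(i, b)`; the relations say precisely that
this is a homomorphism. -/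
theorem isRightAdjoint_powerTo [LY.IsAlgebraic] {Y : AlgClass LY} (hY : IsImplicational Y)
    {K : AlgClass (matrixLang LY κ)}
    (hK : ∀ A : Y.FullSubcategory, K (matrixAlg κ A.obj)) : (powerTo hK).IsRightAdjoint := by
  refine isRightAdjoint_of_universal _ fun B => ?_
  let R := powerRelations B.obj
  let P : Y.FullSubcategory := ⟨presented Y R, presented_mem hY R⟩
  let η : B.obj →[matrixLang LY κ] matrixAlg κ P.obj :=
    { toFun := fun b i => presentedVar Y R (i, b)
      map_fun' := fun t b => sat_powerRelations.1
        (fun p hp => sat_presentedVar.2 (Conseq.of_mem hp)) _ t b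
      map_rel' := fun r => Empty.elim r }
  refine ⟨P, ObjectProperty.homMk η, fun A f => ?_⟩
  let f' : B.obj →[matrixLang LY κ] matrixAlg κ A.obj := f.hom
  let g : P.obj →[LY] A.obj := presentedLift A.property (fun p => f' p.2 p.1)
    (sat_powerRelations.2 fun n t b => f'.map_fun t b)
  refine ⟨ObjectProperty.homMk g, rfl, fun g' hg' => ObjectProperty.hom_ext _ ?_⟩
  refine presented_hom_ext (f := g'.hom) (g := g) fun w => ?_
  exact congrArg (fun k : B ⟶ (powerTo hK).obj A =>
    (show B.obj →[matrixLang LY κ] matrixAlg κ A.obj from k.hom) w.2 w.1) hg'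

/-- Relations on the generators `A` such that the assignments in `B` satisfying them are the
homomorphisms from `A` to `θ_𝓛(B)`. -/
def thetaRelations (τ : Translation LX LY κ) (Θ : Set (Equation LY κ)) (A : Alg LX) :
    Set (Equation (matrixLang LY κ) A) :=
  {e | ∃ (n : ℕ) (ψ : LX.Functions n) (a : Fin n → A),
    e = (Term.var (Structure.funMap ψ a),
      Term.func (L := matrixLang LY κ) (τ n ψ) fun m => Term.var (a m))} ∪
    ⋃ a : A, matrixContextAt Θ a

theorem sat_thetaRelations {τ : Translation LX LY κ} {Θ : Set (Equation LY κ)} {A : Alg LX}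
    {B : Alg (matrixLang LY κ)} {h : A → B} :
    (∀ p ∈ thetaRelations τ Θ A, Sat B h p) ↔
      (∀ (n : ℕ) (ψ : LX.Functions n) (a : Fin n → A), h (Structure.funMap ψ a) =
        Structure.funMap (L := matrixLang LY κ) (τ n ψ) fun m => h (a m)) ∧
      ∀ a, h a ∈ solutions (constContext Θ) B := by
  refine forall_mem_union.trans (and_congr ⟨?_, ?_⟩
    (forall_mem_iUnion.trans (forall_congr' fun _ => sat_matrixContextAt)))
  · exact fun hs n ψ a => hs _ ⟨n, ψ, a, rfl⟩
  · rintro hs _ ⟨n, ψ, a, rfl⟩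
    exact hs n ψ a

/-- The unit sends `a` to its generator, which the context relations place among the solutions of
`θ`. -/
theorem isRightAdjoint_thetaTo [LX.IsAlgebraic] {X : AlgClass LX} {τ : Translation LX LY κ}
    {Θ : Set (Equation LY κ)} {K : AlgClass (matrixLang LY κ)} (hK : IsImplicational K)
    (hc : Compatible K (constContext Θ) τ.image)
    (hθ : ∀ B : K.FullSubcategory, X ((imageReduct τ).obj (thetaAlg hc B))) :
    (thetaTo hc hθ).IsRightAdjoint := by
  have : (matrixLang LY κ).IsAlgebraic := fun _ => inferInstanceAs (IsEmpty Empty)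
  refine isRightAdjoint_of_universal _ fun A => ?_
  let R := thetaRelations τ Θ A.obj
  let P : K.FullSubcategory := ⟨presented K R, presented_mem hK R⟩
  have hP := sat_thetaRelations.1 fun p (hp : p ∈ R) =>
    sat_presentedVar.2 (Conseq.of_mem (C := K) hp)
  let η : A.obj →[LX] (imageReduct τ).obj (thetaAlg hc P) :=
    { toFun := fun a => ⟨presentedVar K R a, hP.2 a⟩
      map_fun' := fun ψ a => Subtype.ext (hP.1 _ ψ a)
      map_rel' := fun r => isEmptyElim r }
  refine ⟨P, ObjectProperty.homMk η, fun B f => ?_⟩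
  let f' : A.obj →[LX] (imageReduct τ).obj (thetaAlg hc B) := f.hom
  let g : P.obj →[matrixLang LY κ] B.obj := presentedLift B.property (fun a => (f' a).1)
    (sat_thetaRelations.2 ⟨fun n ψ a => congrArg Subtype.val (f'.map_fun ψ a), fun a => (f' a).2⟩)
  refine ⟨ObjectProperty.homMk g, rfl, fun g' hg' => ObjectProperty.hom_ext _ ?_⟩
  refine presented_hom_ext (f := g'.hom) (g := g) fun a => ?_
  exact congrArg (fun k : A ⟶ (thetaTo hc hθ).obj B =>
    ((show A.obj →[LX] (imageReduct τ).obj (thetaAlg hc B) from k.hom) a).1) hg'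

end Adjoints

/-! ### Non-triviality -/

section Nontrivial

/-- The one-element algebra. -/
def unitAlg (L : FirstOrder.Language.{u, 0}) : Alg L where
  carrier := PUnit
  str :=
    { funMap := fun _ _ => PUnit.unit
      RelMap := fun _ _ => False }

instance (L : FirstOrder.Language.{u, 0}) : Subsingleton (unitAlg L) :=
  inferInstanceAs (Subsingleton PUnit)

/-- A terminal object of an implicational class has exactly one element. -/
theorem exists_unique_of_isTerminal {L : FirstOrder.Language.{u, 0}} [L.IsAlgebraic]
    {C : AlgClass L} (hC : IsImplicational C) {T : C.FullSubcategory} (hT : Limits.IsTerminal T) :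
    ∃ c : T.obj, ∀ a : T.obj, a = c := by
  let one : C.FullSubcategory := ⟨unitAlg L, hC.of_subsingleton _⟩
  let p : one.obj →[L] T.obj := (hT.from one).hom
  let q : T.obj →[L] one.obj :=
    { toFun := fun _ => PUnit.unit
      map_fun' := fun _ _ => rfl
      map_rel' := fun r => isEmptyElim r }
  refine ⟨p PUnit.unit, fun a => ?_⟩
  -- The identity of `T` equals the constant map through the one-element algebra, which also
  -- excludes an empty `T`.
  exact congrArg (fun k : T ⟶ T => (show T.obj →[L] T.obj from k.hom) a)
    (hT.hom_ext (𝟙 T) (ObjectProperty.homMk q ≫ ObjectProperty.homMk p))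

theorem not_isTrivialRight {LX LY : FirstOrder.Language.{u, 0}} [LX.IsAlgebraic]
    {κ : Type u} [Nonempty κ] {X : AlgClass LX} {Y : AlgClass LY} (hX : IsImplicational X)
    (hY : IsImplicational Y) {τ : Translation LX LY κ} {Θ : Set (Equation LY κ)}
    (hnt : IsNontrivialContext Y Θ) {K : AlgClass (matrixLang LY κ)}
    (hK : ∀ A : Y.FullSubcategory, K (matrixAlg κ A.obj))
    (hc : Compatible K (constContext Θ) τ.image)
    (hθ : ∀ B : K.FullSubcategory, X ((imageReduct τ).obj (thetaAlg hc B))) :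
    ¬ IsTrivialRight (powerTo hK ⋙ thetaTo hc hθ) := by
  intro htriv
  have huniq (A : Alg LY) (hA : Y A) :
      ∃ c : κ → A, (∀ e ∈ Θ, Sat A c e) ∧ ∀ a : κ → A, (∀ e ∈ Θ, Sat A a e) → a = c := by
    obtain ⟨hT⟩ := htriv ⟨A, hA⟩
    obtain ⟨c, hc'⟩ := exists_unique_of_isTerminal hX hT
    exact ⟨c.1, mem_solutions_matrixAlg.1 c.2, fun a ha =>
      congrArg Subtype.val (hc' ⟨a, mem_solutions_matrixAlg.2 ha⟩)⟩
  obtain ⟨i, hi⟩ := hnt <| by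
    -- With no generators and no relations, the elements are classes of closed terms, and what holds
    -- of them there holds throughout `Y`.
    let R : Set (Equation LY PEmpty.{u + 1}) := ∅
    obtain ⟨c, hsat, -⟩ := huniq (presented Y R) (presented_mem hY R)
    obtain ⟨φ, rfl⟩ := (termClass_surjective _).comp_left c
    refine ⟨fun i => (φ i).subst fun x => x.elim, ?_⟩
    rintro _ ⟨e, he, rfl⟩
    have hcons : Conseq Y R (substEq φ e) :=
      (sat_termClass (isCongruence_conseqSetoid Y R) φ e).1 (hsat e he)
    refine fun A hA h _ => sat_substEq.2 ?_
    simp only [Term.realize_subst]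
    exact sat_substEq.1 (hcons A hA _ (by simp [R]))
  refine hi fun A hA h hs => ?_
  obtain ⟨h0, h1⟩ := forall_mem_union.1 hs
  obtain ⟨c, -, hu⟩ := huniq A hA
  exact congrFun ((hu _ (sat_contextAt.1 h0)).trans (hu _ (sat_contextAt.1 h1)).symm) i

end Nontrivial

/-! ### The class `K` -/

section ClassK

variable {LX LY : FirstOrder.Language.{u, 0}} {κ : Type u}

theorem classK_eq_or (X : AlgClass LX) (Y : AlgClass LY) (Θ : Set (Equation LY κ))
    (lam : Cardinal.{u}) :
    (IsQuasiVariety X ∧ IsQuasiVariety Y ∧ CgFinitelyGenerated Y Θ) ∧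
        classK X Y Θ lam = Q (matrixClass κ Y) ∨
      classK X Y Θ lam = GQ lam (matrixClass κ Y) := by
  unfold classK
  split_ifs with h
  · exact Or.inl ⟨h, rfl⟩
  · exact Or.inr rfl

theorem isImplicational_classK (X : AlgClass LX) (Y : AlgClass LY) (Θ : Set (Equation LY κ))
    (lam : Cardinal.{u}) : IsImplicational (classK X Y Θ lam) := by
  obtain ⟨-, h⟩ | h := classK_eq_or X Y Θ lam <;> rw [h]
  · exact Q.isImplicational _
  · exact GQ.isImplicational _ _

theorem matrixClass_le_classK (X : AlgClass LX) (Y : AlgClass LY) (Θ : Set (Equation LY κ))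
    (lam : Cardinal.{u}) : matrixClass κ Y ≤ classK X Y Θ lam := by
  obtain ⟨-, h⟩ | h := classK_eq_or X Y Θ lam <;> rw [h]
  · exact le_Q _
  · exact le_GQ _ _

variable [LX.IsAlgebraic] [LY.IsAlgebraic] [Nonempty κ] {X : AlgClass LX} {Y : AlgClass LY}
  {τ : Translation LX LY κ} {Θ : Set (Equation LY κ)}

/-- Operations are finitary, so compatibility involves finitely many variables: any infinite `lam`
suffices, and a finite `Θ₀` gives finitely many premises. -/
theorem compatible_classK (hY : IsImplicational Y) (hτ : IsContextual X Y τ Θ)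
    {lam : Cardinal.{u}} (hlam : ℵ₀ ≤ lam) :
    Compatible (classK X Y Θ lam) (constContext Θ) τ.image := by
  obtain ⟨⟨-, hYq, hfg⟩, h⟩ | h := classK_eq_or X Y Θ lam <;> rw [h]
  · obtain ⟨Θ₀, hsub, hfin, hΘ₀⟩ := exists_finite_of_cgFinitelyGenerated hYq hY hfg
    exact compatible_of_conseq hτ hsub hΘ₀ fun n e he =>
      he.to_Q (Set.finite_iUnion fun j => finite_matrixContextAt hfin j)
  · exact compatible_of_conseq hτ Set.Subset.rfl (fun _ => Conseq.of_mem) fun n e he =>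
      he.to_GQ_of_countable hlam

theorem theta_mem (hX : IsImplicational X) (hY : IsImplicational Y) (hτ : IsContextual X Y τ Θ)
    {lam : Cardinal.{u}} (hlam : U lam X = X)
    (hc : Compatible (classK X Y Θ lam) (constContext Θ) τ.image)
    (B : (classK X Y Θ lam).FullSubcategory) : X ((imageReduct τ).obj (thetaAlg hc B)) := by
  obtain ⟨⟨hXq, hYq, hfg⟩, h⟩ | h := classK_eq_or X Y Θ lam
  · obtain ⟨Θ₀, hsub, hfin, hΘ₀⟩ := exists_finite_of_cgFinitelyGenerated hYq hY hfg
    exact theta_mem_of_Q hc B hXq hτ hsub hfin hΘ₀ h.le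
  · exact theta_mem_of_U hc B hX hτ hlam h.le

end ClassK

end CtxTrans

theorem theorem3p4 {LX LY : FirstOrder.Language.{u, 0}} [LX.IsAlgebraic] [LY.IsAlgebraic]
    (X : AlgClass LX) (Y : AlgClass LY)
    (hX : IsGenQuasiVariety X) (hY : IsGenQuasiVariety Y)
    (κ : Type u) [Nonempty κ]
    (τ : Translation LX LY κ) (Θ : Set (Equation LY κ))
    (hτ : IsContextual X Y τ Θ) (hnt : IsNontrivialContext Y Θ) :
    (∃ lam : Cardinal.{u}, ℵ₀ ≤ lam ∧ U lam X = X) ∧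
    ∀ lam : Cardinal.{u}, ℵ₀ ≤ lam → U lam X = X →
      ∃ (hK : ∀ A : Y.FullSubcategory, classK X Y Θ lam (matrixAlg κ A.obj))
        (hc : Compatible (classK X Y Θ lam) (constContext Θ) τ.image)
        (hθ : ∀ B : (classK X Y Θ lam).FullSubcategory,
            X ((imageReduct τ).obj (thetaAlg hc B))),
        (powerTo hK).IsRightAdjoint ∧ (thetaTo hc hθ).IsRightAdjoint ∧
          (powerTo hK ⋙ thetaTo hc hθ).IsRightAdjoint ∧
          ¬ IsTrivialRight (powerTo hK ⋙ thetaTo hc hθ) := by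
  refine ⟨hX.exists_U_eq, fun lam hlam hU => ?_⟩
  have hX' := hX.isImplicational
  have hY' := hY.isImplicational
  have hc := compatible_classK hY' hτ hlam
  have hK (A : Y.FullSubcategory) : classK X Y Θ lam (matrixAlg κ A.obj) :=
    matrixClass_le_classK X Y Θ lam _ ⟨A.obj, A.property, ⟨Iso.refl _⟩⟩
  have hθ := theta_mem hX' hY' hτ hU hc
  have hpow := isRightAdjoint_powerTo hY' hK
  have htheta := isRightAdjoint_thetaTo (isImplicational_classK X Y Θ lam) hc hθ
  exact ⟨hK, hc, hθ, hpow, htheta, Functor.isRightAdjoint_comp,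
    not_isTrivialRight hX' hY' hnt hK hc hθ⟩
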